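/- Let $S\ge 1$ and $n_x,n_y\ge 0$ be integers, and let $\mathcal K_0\subseteq\mathbb R^{n_x}$ and $\mathcal K_i\subseteq\mathbb R^{n_y}$, $i=1,\dots,S$, be nonempty closed convex cones. Let $A\in\mathbb R^{n_x\times n_x}$, $a,f_0,f_i\in\mathbb R^{n_x}$, $B_i\in\mathbb R^{n_x\times n_y}$, $C_i\in\mathbb R^{n_y\times n_y}$, $c_i,g_i\in\mathbb R^{n_y}$, $d_0,d_i\in\mathbb R$. Write $M\bullet N=\mathrm{trace}(M^{\mathsf T}N)$, and for a cone $\mathcal K$ let $\mathcal K^*=\{z : z^{\mathsf T}y\ge 0\ \forall y\in\mathcal K\}$ and $\mathrm{CPP}(\mathcal K)=\mathrm{conv}\{vv^{\mathsf T} : v\in\mathcal K\}$. For a set $\mathcal F\subseteq\mathbb R^n$ let $\mathcal G(\mathcal F)=\mathrm{cl}\,\mathrm{conv}\left\{\begin{bmatrix}1\\ v\end{bmatrix}\begin{bmatrix}1\\ v\end{bmatrix}^{\mathsf T} : v\in\mathcal F\right\}$. Consider the conic quadratic problem $$\mathrm{(QP)}\quad \inf_{x,y_1,\dots,y_S}\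 x^{\mathsf T}Ax+a^{\mathsf T}x+\sum_{i=1}^S\left(x^{\mathsf T}B_iy_i+y_i^{\mathsf T}C_iy_i+c_i^{\mathsf T}y_i\right)$$ subject to $f_0^{\mathsf T}x=d_0$, $x\in\mathcal K_0$, and $f_i^{\mathsf T}x+g_i^{\mathsf T}y_i=d_i$, $y_i\in\mathcal K_i$ for $i=1,\dots,S$; and the problem $$\mathrm{(R)}\quad \inf_{x,X,y_i,Y_i,Z_i}\ A\bullet X+a^{\mathsf T}x+\sum_{i=1}^S\left(B_i\bullet Z_i^{\mathsf T}+C_i\bullet Y_i+c_i^{\mathsf T}y_i\right)$$ over $x\in\mathbb R^{n_x}$, $X\in\mathbb R^{n_x\times n_x}$, $y_i\in\mathbb R^{n_y}$, $Y_i\in\mathbb R^{n_y\times n_y}$, $Z_i\in\mathbb R^{n_y\times n_x}$, subject to $f_0^{\mathsf T}x=d_0$, $f_0f_0^{\mathsf T}\bullet X=d_0^2$ and, for $i=1,\dots,S$, $$f_i^{\mathsf T}x+g_i^{\mathsf T}y_i=d_i,\qquad f_if_i^{\mathsf T}\bullet X+2\,f_ig_i^{\mathsf T}\bullet Z_i^{\mathsf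 T}+g_ig_i^{\mathsf T}\bullet Y_i=d_i^2,\qquad \begin{bmatrix}1&x^{\mathsf T}&y_i^{\mathsf T}\\ x&X&Z_i^{\mathsf T}\\ y_i&Z_i&Y_i\end{bmatrix}\in\mathrm{CPP}(\mathbb R_+\times\mathcal K_0\times\mathcal K_i).$$ Optimal values are taken in $[-\infty,+\infty]$, with $\inf\emptyset=+\infty$. Then the optimal value of (R) is a lower bound on the optimal value of (QP). Moreover, let $\mathcal F_0=\{x\in\mathcal K_0 : f_0^{\mathsf T}x=d_0\}$, $\mathcal F_i=\{(x,y)\in\mathcal K_0\times\mathcal K_i : f_i^{\mathsf T}x+g_i^{\mathsf T}y=d_i\}$, $$\mathcal X_0=\left\{(x,X) : \begin{bmatrix}1&x^{\mathsf T}\\ x&X\end{bmatrix}\in\mathcal G(\mathcal F_0)\right\},\qquad \mathcal X_i=\left\{(x,X) : \exists\,(y,Y,Z):\ \begin{bmatrix}1&x^{\mathsf T}&y^{\mathsf T}\\ x&X&Z^{\mathsf T}\\ y&Z&Y\end{bmatrix}\in\mathcal G(\mathcal F_i)\right\},\quad i=1,\dots,S,$$ and $\mathcal X=\bigcap_{i=0}^S\mathcal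 X_i$. Suppose that there are $\beta_i\in\mathbb R$ and $b_i\in\mathbb R^{n_x}$ with $c_i=\beta_ig_i$ and $B_i=b_ig_i^{\mathsf T}$ for $i=1,\dots,S$, and that 1. $g_i\in\mathrm{int}(\mathcal K_i^*)$ for $i=1,\dots,S$; 2. $\mathcal X$ is bounded; 3. every extreme point of $\mathcal X$ is of the form $(x,xx^{\mathsf T})$. Then the bound is exact, i.e. the optimal values of (R) and (QP) are equal. -/

import Mathlib

open scoped Matrix

noncomputable section

namespace ConicQP

/-- The Frobenius product `M • N = trace (Mᵀ N) = ∑ i, ∑ j, M i j * N i j`. -/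
def frob {m n : Type*} [Fintype m] [Fintype n] (M N : Matrix m n ℝ) : ℝ :=
  (Mᵀ * N).trace

/-- The set-completely positive cone over `K`: the convex hull of all `x xᵀ`, `x ∈ K`. -/
def CPP {ι : Type*} (K : Set (ι → ℝ)) : Set (Matrix ι ι ℝ) :=
  convexHull ℝ ((fun v => Matrix.vecMulVec v v) '' K)

/-- The Cartesian product `K × L`, as a set of vectors indexed by a disjoint union. -/
def prodSet {ι κ : Type*} (K : Set (ι → ℝ)) (L : Set (κ → ℝ)) : Set (ι ⊕ κ → ℝ) :=
  {v | (fun i => v (Sum.inl i)) ∈ K ∧ (fun k => v (Sum.inr k)) ∈ L}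

/-- The half-line `ℝ₊`, as a set of vectors with one coordinate. -/
def ray : Set (Unit → ℝ) := {v | 0 ≤ v ()}

/-- The vector `(1, x)`. -/
def lift {ι : Type*} (x : ι → ℝ) : Unit ⊕ ι → ℝ := Sum.elim (fun _ => 1) x

/-- The closed convex hull of all matrices `(1, x) (1, x)ᵀ` with `x ∈ F`. -/
def GG {ι : Type*} (F : Set (ι → ℝ)) : Set (Matrix (Unit ⊕ ι) (Unit ⊕ ι) ℝ) :=
  closure (convexHull ℝ ((fun x => Matrix.vecMulVec (lift x) (lift x)) '' F))

/-- The bordered matrix `[[1, xᵀ], [x, X]]`. -/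
def bordered {ι : Type*} (x : ι → ℝ) (X : Matrix ι ι ℝ) :
    Matrix (Unit ⊕ ι) (Unit ⊕ ι) ℝ :=
  Matrix.fromBlocks 1 (Matrix.replicateRow Unit x) (Matrix.replicateCol Unit x) X

/-- The block matrix `[[1, xᵀ, yᵀ], [x, X, Zᵀ], [y, Z, Y]]`. -/
def arrowBlock {ι κ : Type*} (x : ι → ℝ) (X : Matrix ι ι ℝ) (y : κ → ℝ) (Y : Matrix κ κ ℝ)
    (Z : Matrix κ ι ℝ) : Matrix (Unit ⊕ (ι ⊕ κ)) (Unit ⊕ (ι ⊕ κ)) ℝ :=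
  bordered (Sum.elim x y) (Matrix.fromBlocks X Zᵀ Z Y)

/-- The dual cone `{z | ⟨y, z⟩ ≥ 0 for all y ∈ K}` with respect to the standard inner product. -/
def dualCone {ι : Type*} [Fintype ι] (K : Set (ι → ℝ)) : Set (ι → ℝ) :=
  (PointedCone.dual (dotProductBilin ℝ ℝ) K : PointedCone ℝ (ι → ℝ))

/-- The data of a decomposable conic quadratic problem. The ground cones are nonempty closed
convex cones (Mathlib's `ProperCone`; no interior or pointedness is required). -/
structure Problem (nx ny S : ℕ) where
  K0 : ProperCone ℝ (Fin nx → ℝ)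
  K : Fin S → ProperCone ℝ (Fin ny → ℝ)
  A : Matrix (Fin nx) (Fin nx) ℝ
  a : Fin nx → ℝ
  B : Fin S → Matrix (Fin nx) (Fin ny) ℝ
  C : Fin S → Matrix (Fin ny) (Fin ny) ℝ
  c : Fin S → Fin ny → ℝ
  f0 : Fin nx → ℝ
  d0 : ℝ
  f : Fin S → Fin nx → ℝ
  g : Fin S → Fin ny → ℝ
  d : Fin S → ℝ

/-- The variables of the sparse relaxation. -/
structure LiftedPoint (nx ny S : ℕ) where
  x : Fin nx → ℝ
  X : Matrix (Fin nx) (Fin nx) ℝ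
  y : Fin S → Fin ny → ℝ
  Y : Fin S → Matrix (Fin ny) (Fin ny) ℝ
  Z : Fin S → Matrix (Fin ny) (Fin nx) ℝ

namespace Problem

variable {nx ny S : ℕ} (P : Problem nx ny S)

/-- The feasible set of the conic quadratic problem. -/
def feasible : Set ((Fin nx → ℝ) × (Fin S → Fin ny → ℝ)) :=
  {p | P.f0 ⬝ᵥ p.1 = P.d0 ∧ p.1 ∈ P.K0 ∧
    (∀ i, P.f i ⬝ᵥ p.1 + P.g i ⬝ᵥ p.2 i = P.d i) ∧ ∀ i, p.2 i ∈ P.K i}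

/-- The objective `xᵀAx + aᵀx + ∑ i, (xᵀ Bᵢ yᵢ + yᵢᵀ Cᵢ yᵢ + cᵢᵀ yᵢ)`. -/
def objective (p : (Fin nx → ℝ) × (Fin S → Fin ny → ℝ)) : ℝ :=
  p.1 ⬝ᵥ P.A *ᵥ p.1 + P.a ⬝ᵥ p.1 +
    ∑ i, (p.1 ⬝ᵥ P.B i *ᵥ p.2 i + p.2 i ⬝ᵥ P.C i *ᵥ p.2 i + P.c i ⬝ᵥ p.2 i)

/-- The optimal value of the conic quadratic problem (`+∞` if it is infeasible). -/
def val : EReal := ⨅ p ∈ P.feasible, (P.objective p : EReal)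

/-- The feasible set of the sparse relaxation. As `Zᵢ` stands for `yᵢ xᵀ`, the bilinear form of an
`nx × ny` matrix is evaluated at `Zᵢᵀ`. -/
def relaxedFeasible : Set (LiftedPoint nx ny S) :=
  {p | P.f0 ⬝ᵥ p.x = P.d0 ∧ frob (Matrix.vecMulVec P.f0 P.f0) p.X = P.d0 ^ 2 ∧
    (∀ i, P.f i ⬝ᵥ p.x + P.g i ⬝ᵥ p.y i = P.d i) ∧
    (∀ i, frob (Matrix.vecMulVec (P.f i) (P.f i)) p.X
        + 2 * frob (Matrix.vecMulVec (P.f i) (P.g i)) (p.Z i)ᵀ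
        + frob (Matrix.vecMulVec (P.g i) (P.g i)) (p.Y i) = P.d i ^ 2) ∧
    ∀ i, arrowBlock p.x p.X (p.y i) (p.Y i) (p.Z i) ∈
      CPP (prodSet ray (prodSet (P.K0 : Set (Fin nx → ℝ)) (P.K i : Set (Fin ny → ℝ))))}

/-- The objective of the sparse relaxation. -/
def relaxedObjective (p : LiftedPoint nx ny S) : ℝ :=
  frob P.A p.X + P.a ⬝ᵥ p.x +
    ∑ i, (frob (P.B i) (p.Z i)ᵀ + frob (P.C i) (p.Y i) + P.c i ⬝ᵥ p.y i)

/-- The optimal value of the sparse relaxation (`+∞` if it is infeasible). -/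
def relaxedVal : EReal := ⨅ p ∈ P.relaxedFeasible, (P.relaxedObjective p : EReal)

/-- `F₀ = {x ∈ K₀ | f₀ᵀ x = d₀}`. -/
def F0 : Set (Fin nx → ℝ) := {x | x ∈ P.K0 ∧ P.f0 ⬝ᵥ x = P.d0}

/-- `Fᵢ = {(x, y) ∈ K₀ × Kᵢ | fᵢᵀ x + gᵢᵀ y = dᵢ}`. -/
def F (i : Fin S) : Set (Fin nx ⊕ Fin ny → ℝ) :=
  {v | v ∈ prodSet (P.K0 : Set (Fin nx → ℝ)) (P.K i : Set (Fin ny → ℝ)) ∧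
    P.f i ⬝ᵥ (fun j => v (Sum.inl j)) + P.g i ⬝ᵥ (fun k => v (Sum.inr k)) = P.d i}

/-- `𝒳₀`: all `(x, X)` whose bordered matrix lies in `GG F₀`. -/
def XX0 : Set ((Fin nx → ℝ) × Matrix (Fin nx) (Fin nx) ℝ) :=
  {p | bordered p.1 p.2 ∈ GG P.F0}

/-- `𝒳ᵢ`: the projection of `GG Fᵢ` to the coordinates `(x, X)`. -/
def XXi (i : Fin S) : Set ((Fin nx → ℝ) × Matrix (Fin nx) (Fin nx) ℝ) :=
  {p | ∃ (y : Fin ny → ℝ) (Y : Matrix (Fin ny) (Fin ny) ℝ) (Z : Matrix (Fin ny) (Fin nx) ℝ),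
    arrowBlock p.1 p.2 y Y Z ∈ GG (P.F i)}

/-- The intersection `𝒳` of `𝒳₀, 𝒳₁, …, 𝒳_S`. -/
def XX : Set ((Fin nx → ℝ) × Matrix (Fin nx) (Fin nx) ℝ) :=
  P.XX0 ∩ ⋂ i, P.XXi i

end Problem

/-- Boundedness of a set of pairs (vector, matrix): all entries are uniformly bounded. -/
def IsBoundedPairs {ι : Type*} (T : Set ((ι → ℝ) × Matrix ι ι ℝ)) : Prop :=
  ∃ R : ℝ, ∀ p ∈ T, (∀ j, |p.1 j| ≤ R) ∧ ∀ j k, |p.2 j k| ≤ R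

end ConicQP

end

/-!
Substituting `X = x xᵀ`, `Yᵢ = yᵢ yᵢᵀ`, `Zᵢ = yᵢ xᵀ` maps feasible points of the conic quadratic
problem to feasible points of the relaxation with the same objective, which gives the lower bound.

For exactness, every feasible point of the relaxation is dominated by a feasible point of the
original problem. The arrow block of index `i` lies in the closed convex hull of the lifted points
of `Fᵢ` (`bordered_mem_GG`), so `(x, X) ∈ 𝒳`. As `gᵢ` is interior to the dual cone, the slice
`{y ∈ Kᵢ | gᵢᵀ y = 1}` is compact, and a minimizer `wᵢ` of `yᵀ Cᵢ y` on it gives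
`yᵀ Cᵢ y ≥ (wᵢᵀ Cᵢ wᵢ) (gᵢᵀ y)²` on `Kᵢ` (`exists_minimizer_on_slice`). On `Fᵢ` one has
`gᵢᵀ y = dᵢ - fᵢᵀ x`, and since `Bᵢ` and `cᵢ` involve `y` only through `gᵢᵀ y`, the terms of block
`i` are at least a quadratic function of `x` alone. This inequality is affine in the lifted
variables, hence extends to the closed convex hull (`affine_le_of_mem_GG`): the relaxed
objective is at least an affine function of `(x, X)`, called `reduced`.

The set `𝒳` is compact (`isCompact_XX`), so the minimum of `reduced` over `𝒳` is attained at an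
extreme point, by hypothesis of the form `(x, x xᵀ)`. Such an `x` lies in the projection of every
`Fᵢ`, and completing it by `yᵢ = (dᵢ - fᵢᵀ x) wᵢ` gives a feasible point of the original problem
whose objective is the value of `reduced` there.
-/

open scoped Matrix

noncomputable section

namespace ConicQP

/-! ### Closed convex hulls of lifted points -/

theorem GG_subset {ι : Type*} {F : Set (ι → ℝ)} {T : Set (Matrix (Unit ⊕ ι) (Unit ⊕ ι) ℝ)}
    (hT : IsClosed T) (hconv : Convex ℝ T)
    (h : ∀ v ∈ F, Matrix.vecMulVec (lift v) (lift v) ∈ T) : GG F ⊆ T :=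
  closure_minimal (convexHull_min (Set.image_subset_iff.2 h) hconv) hT

/-- Affine inequalities are covered as well: constants are multiplied by the corner entry, which is
`1` on `GG F`. -/
theorem nonneg_of_mem_GG {ι : Type*} {F : Set (ι → ℝ)}
    {l : Matrix (Unit ⊕ ι) (Unit ⊕ ι) ℝ → ℝ} (hl : IsLinearMap ℝ l) (hc : Continuous l)
    (h : ∀ v ∈ F, 0 ≤ l (Matrix.vecMulVec (lift v) (lift v)))
    {M : Matrix (Unit ⊕ ι) (Unit ⊕ ι) ℝ} (hM : M ∈ GG F) : 0 ≤ l M :=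
  GG_subset (isClosed_Ici.preimage hc) ((convex_Ici (0 : ℝ)).is_linear_preimage hl) h hM

theorem eq_zero_of_mem_GG {ι : Type*} {F : Set (ι → ℝ)}
    {l : Matrix (Unit ⊕ ι) (Unit ⊕ ι) ℝ → ℝ} (hl : IsLinearMap ℝ l) (hc : Continuous l)
    (h : ∀ v ∈ F, l (Matrix.vecMulVec (lift v) (lift v)) = 0)
    {M : Matrix (Unit ⊕ ι) (Unit ⊕ ι) ℝ} (hM : M ∈ GG F) : l M = 0 :=
  GG_subset (isClosed_singleton.preimage hc)
    ((convex_singleton (0 : ℝ)).is_linear_preimage hl) h hM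

theorem GG_symm {ι : Type*} {F : Set (ι → ℝ)} {M : Matrix (Unit ⊕ ι) (Unit ⊕ ι) ℝ}
    (hM : M ∈ GG F) (i j) : M i j = M j i := by
  have := eq_zero_of_mem_GG (l := fun M => M i j - M j i)
    ⟨fun _ _ => by simp; ring, fun _ _ => by simp; ring⟩ (by fun_prop)
    (fun v _ => by simp [Matrix.vecMulVec_apply]; ring) hM
  linarith

theorem GG_corner {ι : Type*} {F : Set (ι → ℝ)} {M : Matrix (Unit ⊕ ι) (Unit ⊕ ι) ℝ}
    (hM : M ∈ GG F) : M (Sum.inl ()) (Sum.inl ()) = 1 := by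
  refine GG_subset (T := {M | M (Sum.inl ()) (Sum.inl ()) = 1}) ?_ ?_ ?_ hM
  · exact isClosed_eq (by fun_prop) continuous_const
  · exact (convex_singleton (1 : ℝ)).is_linear_preimage
      (f := fun M : Matrix (Unit ⊕ ι) (Unit ⊕ ι) ℝ => M (Sum.inl ()) (Sum.inl ()))
      ⟨fun _ _ => rfl, fun _ _ => rfl⟩
  · intro v _
    simp [Matrix.vecMulVec_apply, lift]

/-- The matrices in `GG F` are positive semidefinite, so the diagonal controls all entries. -/
theorem GG_abs_le {ι : Type*} {F : Set (ι → ℝ)} {M : Matrix (Unit ⊕ ι) (Unit ⊕ ι) ℝ}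
    (hM : M ∈ GG F) (i j) : 2 * |M i j| ≤ M i i + M j j := by
  have h1 := nonneg_of_mem_GG (l := fun M => M i i + M j j - 2 * M i j)
    ⟨fun _ _ => by simp; ring, fun _ _ => by simp; ring⟩ (by fun_prop)
    (fun v _ => by
      simp only [Matrix.vecMulVec_apply]; nlinarith [sq_nonneg (lift v i - lift v j)]) hM
  have h2 := nonneg_of_mem_GG (l := fun M => M i i + M j j + 2 * M i j)
    ⟨fun _ _ => by simp; ring, fun _ _ => by simp; ring⟩ (by fun_prop)
    (fun v _ => by
      simp only [Matrix.vecMulVec_apply]; nlinarith [sq_nonneg (lift v i + lift v j)]) hM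
  rcases abs_cases (M i j) with h | h <;> linarith

theorem border_mem_of_mem_GG {ι : Type*} {F T : Set (ι → ℝ)} (hT : IsClosed T)
    (hconv : Convex ℝ T) (hFT : F ⊆ T) {M : Matrix (Unit ⊕ ι) (Unit ⊕ ι) ℝ} (hM : M ∈ GG F) :
    (fun j => M (Sum.inl ()) (Sum.inr j)) ∈ T := by
  refine GG_subset (T := (fun M j => M (Sum.inl ()) (Sum.inr j)) ⁻¹' T) ?_ ?_ ?_ hM
  · exact hT.preimage (by fun_prop)
  · exact hconv.is_linear_preimage ⟨fun _ _ => rfl, fun _ _ => rfl⟩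
  · intro v hv
    simpa [Matrix.vecMulVec_apply, lift] using hFT hv

/-! ### Completely positive matrices on a hyperplane -/

/-- For a cone `K` the weights of a convex combination can be absorbed into the vectors. -/
theorem exists_sum_of_mem_CPP {ι : Type*} {K : Set (ι → ℝ)}
    (hsmul : ∀ c : ℝ, 0 ≤ c → ∀ v ∈ K, c • v ∈ K) {M : Matrix ι ι ℝ} (hM : M ∈ CPP K) :
    ∃ (n : ℕ) (z : Fin n → ι → ℝ), (∀ k, z k ∈ K) ∧ M = ∑ k, Matrix.vecMulVec (z k) (z k) := by
  rw [CPP, convexHull_eq] at hM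
  obtain ⟨κ, t, w, z, hw, hw1, hz, rfl⟩ := hM
  choose! v hv hvz using hz
  let e := t.equivFin
  refine ⟨t.card, fun k => √(w (e.symm k)) • v (e.symm k), fun k =>
    hsmul _ (Real.sqrt_nonneg _) _ (hv _ (e.symm k).2), ?_⟩
  rw [Finset.centerMass_eq_of_sum_1 _ _ hw1, ← Finset.sum_coe_sort t, ← e.symm.sum_comp]
  refine Finset.sum_congr rfl fun k _ => ?_
  rw [Matrix.smul_vecMulVec, Matrix.vecMulVec_smul, smul_smul,
    Real.mul_self_sqrt (hw _ (e.symm k).2)]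
  exact congrArg _ (hvz _ (e.symm k).2).symm

/-- In a decomposition `∑ zₖ zₖᵀ` of the bordered matrix, `zₖ = (sₖ, uₖ)`, the two equations on
`f` and `d` say `∑ (fᵀ uₖ - d sₖ)² = 0`, so every `uₖ` lies on the hyperplane `fᵀ u = d sₖ`. If
`sₖ > 0`, then `uₖ / sₖ` is a point of the slice. The terms with `sₖ = 0` are recession directions:
they are reached as limits, which is why the closure in `GG` is needed. -/
theorem bordered_mem_GG {ι : Type*} [Fintype ι] {K : Set (ι → ℝ)}
    (hadd : ∀ u ∈ K, ∀ v ∈ K, u + v ∈ K) (hsmul : ∀ c : ℝ, 0 ≤ c → ∀ v ∈ K, c • v ∈ K)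
    {f : ι → ℝ} {d : ℝ} {x : ι → ℝ} {X : Matrix ι ι ℝ}
    (hM : bordered x X ∈ CPP (prodSet ray K)) (h1 : f ⬝ᵥ x = d) (h2 : f ⬝ᵥ X *ᵥ f = d ^ 2) :
    bordered x X ∈ GG {v | v ∈ K ∧ f ⬝ᵥ v = d} := by
  obtain ⟨n, z, hz, hM⟩ := exists_sum_of_mem_CPP (K := prodSet ray K)
    (fun c hc v hv => ⟨mul_nonneg hc hv.1, hsmul c hc _ hv.2⟩) hM
  set s : Fin n → ℝ := fun k => z k (Sum.inl ()) with hs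
  set u : Fin n → ι → ℝ := fun k j => z k (Sum.inr j) with hu
  have hs0 : ∀ k, 0 ≤ s k := fun k => (hz k).1
  have huK : ∀ k, u k ∈ K := fun k => (hz k).2
  have hentry : ∀ a b, bordered x X a b = ∑ k, z k a * z k b := fun a b => by
    rw [hM, Matrix.sum_apply]; rfl
  have hone : ∑ k, s k * s k = 1 := by
    simpa [bordered] using (hentry (Sum.inl ()) (Sum.inl ())).symm
  have hx : x = ∑ k, s k • u k := by
    ext j
    simpa [bordered] using hentry (Sum.inl ()) (Sum.inr j)
  have hX : X = ∑ k, Matrix.vecMulVec (u k) (u k) := by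
    ext j l
    rw [Matrix.sum_apply]
    simpa [bordered, Matrix.vecMulVec_apply] using hentry (Sum.inr j) (Sum.inr l)
  -- A weighted sum of squares vanishes, hence so does each square.
  have hzero : ∀ k, f ⬝ᵥ u k = d * s k := by
    have e1 : ∑ k, s k * (f ⬝ᵥ u k) = d := by
      rw [← h1, hx, dotProduct_sum]; simp
    have e2 : ∑ k, (f ⬝ᵥ u k) ^ 2 = d ^ 2 := by
      rw [← h2, hX, Matrix.sum_mulVec, dotProduct_sum]
      refine Finset.sum_congr rfl fun k _ => ?_
      rw [Matrix.vecMulVec_mulVec]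
      simp [dotProduct_comm (u k) f, sq]
    have e3 : ∑ k, (f ⬝ᵥ u k - d * s k) ^ 2 = 0 := by
      have : ∀ k, (f ⬝ᵥ u k - d * s k) ^ 2 =
          (f ⬝ᵥ u k) ^ 2 - 2 * d * (s k * (f ⬝ᵥ u k)) + d ^ 2 * (s k * s k) := fun k => by ring
      simp only [this, Finset.sum_add_distrib, Finset.sum_sub_distrib, ← Finset.mul_sum, e1, e2,
        hone]
      ring
    intro k
    have := (Finset.sum_eq_zero_iff_of_nonneg (fun k _ => sq_nonneg _)).1 e3 k (Finset.mem_univ k)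
    exact sub_eq_zero.1 (pow_eq_zero_iff two_ne_zero |>.1 this)
  obtain ⟨k₀, hk₀⟩ : ∃ k, 0 < s k := by
    by_contra! h
    have : ∀ k, s k = 0 := fun k => le_antisymm (h k) (hs0 k)
    simp [this] at hone
  set v₀ := (s k₀)⁻¹ • u k₀ with hv₀
  have hv₀K : v₀ ∈ K := hsmul _ (inv_nonneg.2 hk₀.le) _ (huK _)
  have hv₀d : f ⬝ᵥ v₀ = d := by
    rw [hv₀, dotProduct_smul, hzero, smul_eq_mul]; field_simp
  -- Shifting every `zₖ` by `ε (1, v₀)` makes all leading coordinates positive, so that each term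
  -- is a multiple of a lifted point of the slice; `N ε` renormalizes the corner entry to `1`.
  let N : ℝ → ℝ := fun ε => ∑ k, (s k + ε) ^ 2
  let G : ℝ → Matrix (Unit ⊕ ι) (Unit ⊕ ι) ℝ := fun ε =>
    (N ε)⁻¹ • ∑ k, Matrix.vecMulVec (z k + ε • lift v₀) (z k + ε • lift v₀)
  have hN0 : N 0 = 1 := by simpa [N, sq] using hone
  have hG0 : G 0 = bordered x X := by simp [G, hN0, hM]
  have hcont : ContinuousAt G 0 := by
    have hN : Continuous N := by fun_prop
    refine (hN.continuousAt.inv₀ (by simp [hN0])).smul (Continuous.continuousAt ?_)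
    refine continuous_finsetSum _ fun k _ => ?_
    have : Continuous fun ε : ℝ => z k + ε • lift v₀ := by fun_prop
    exact this.matrix_vecMulVec this
  have hlim : Filter.Tendsto G (nhdsWithin 0 (Set.Ioi 0)) (nhds (bordered x X)) :=
    hG0 ▸ hcont.tendsto.mono_left nhdsWithin_le_nhds
  refine mem_closure_of_tendsto hlim ?_
  filter_upwards [self_mem_nhdsWithin] with ε hε
  have hε : 0 < ε := hε
  have hpos : ∀ k, 0 < s k + ε := fun k => add_pos_of_nonneg_of_pos (hs0 k) hε
  have hNpos : 0 < N ε :=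
    Finset.sum_pos (fun k _ => pow_pos (hpos k) 2) ⟨k₀, Finset.mem_univ _⟩
  have hGeq : G ε = ∑ k, ((N ε)⁻¹ * (s k + ε) ^ 2) •
      Matrix.vecMulVec (lift ((s k + ε)⁻¹ • (u k + ε • v₀)))
        (lift ((s k + ε)⁻¹ • (u k + ε • v₀))) := by
    have key : ∀ k, z k + ε • lift v₀ = (s k + ε) • lift ((s k + ε)⁻¹ • (u k + ε • v₀)) := by
      intro k
      have := (hpos k).ne'
      ext (a | j)
      · simp [lift, hs]
      · simp only [lift, hu, Pi.add_apply, Pi.smul_apply, smul_eq_mul, Sum.elim_inr]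
        field_simp
    simp only [G, Finset.smul_sum, key, Matrix.smul_vecMulVec, Matrix.vecMulVec_smul, smul_smul]
    refine Finset.sum_congr rfl fun k _ => ?_
    congr 1; ring
  rw [hGeq]
  refine (convex_convexHull ℝ _).sum_mem (fun k _ => by positivity) ?_ fun k _ =>
    subset_convexHull ℝ _ ⟨_, ⟨?_, ?_⟩, rfl⟩
  · rw [← Finset.mul_sum]; exact inv_mul_cancel₀ hNpos.ne'
  · exact hsmul _ (inv_nonneg.2 (hpos k).le) _
      (hadd _ (huK k) _ (hsmul _ hε.le _ hv₀K))
  · have := (hpos k).ne'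
    rw [dotProduct_smul, dotProduct_add, dotProduct_smul, hzero, hv₀d, smul_eq_mul, smul_eq_mul]
    field_simp

/-! ### Minimizing a quadratic form on a slice of a cone -/

theorem exists_pos_mul_abs_le_dotProduct {ι : Type*} [Fintype ι] [DecidableEq ι]
    {K : Set (ι → ℝ)} {g : ι → ℝ} (hg : g ∈ interior (dualCone K)) :
    ∃ ε > 0, ∀ y ∈ K, ∀ j, ε * |y j| ≤ g ⬝ᵥ y := by
  obtain ⟨δ, hδ, hball⟩ := Metric.mem_nhds_iff.1 (mem_interior_iff_mem_nhds.1 hg)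
  refine ⟨δ / 2, by positivity, fun y hy j => ?_⟩
  -- All `g + t eⱼ` with `|t| < δ` still lie in the dual cone.
  have key : ∀ t : ℝ, |t| < δ → 0 ≤ g ⬝ᵥ y + t * y j := by
    intro t ht
    have hmem : g + Pi.single j t ∈ dualCone K := by
      refine hball ?_
      simpa [dist_eq_norm, Pi.norm_single] using ht
    have := hmem hy
    simpa [dotProductBilin, dotProduct_comm y, add_dotProduct] using this
  have h1 := key (δ / 2) (by rw [abs_of_pos] <;> linarith)
  have h2 := key (-(δ / 2)) (by rw [abs_neg, abs_of_pos] <;> linarith)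
  rcases abs_cases (y j) with h | h <;> rw [h.1] <;> linarith

/-- The vector `w` minimizes `yᵀ C y` on the compact slice `{y ∈ K | gᵀ y = 1}`, and homogeneity
extends the bound to all of `K`. If the slice is empty, then `K = {0}` and `w = 0`; the last
conjunct, `gᵀ w = 1` unless `gᵀ` vanishes on `K`, covers both cases. -/
theorem exists_minimizer_on_slice {ι : Type*} [Fintype ι] (K : ProperCone ℝ (ι → ℝ))
    (C : Matrix ι ι ℝ) {g : ι → ℝ} {ε : ℝ} (hε : 0 < ε)
    (hg : ∀ y ∈ K, ∀ j, ε * |y j| ≤ g ⬝ᵥ y) :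
    ∃ w ∈ K, (∀ v ∈ K, (g ⬝ᵥ v) ^ 2 * (w ⬝ᵥ C *ᵥ w) ≤ v ⬝ᵥ C *ᵥ v) ∧
      ∀ v ∈ K, (g ⬝ᵥ v) * (g ⬝ᵥ w) = g ⬝ᵥ v := by
  have hzero : ∀ v ∈ K, g ⬝ᵥ v ≤ 0 → v = 0 := by
    intro v hv h
    ext j
    have := hg v hv j
    have h3 : |v j| ≤ 0 := by
      by_contra! h4
      have := mul_pos hε h4
      linarith
    exact abs_nonpos_iff.1 h3
  have hscale : ∀ v ∈ K, 0 < g ⬝ᵥ v →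
      (g ⬝ᵥ v)⁻¹ • v ∈ K ∧ g ⬝ᵥ ((g ⬝ᵥ v)⁻¹ • v) = 1 := fun v hv h =>
    ⟨K.smul_mem hv (inv_nonneg.2 h.le), by
      rw [dotProduct_smul, smul_eq_mul, inv_mul_cancel₀ h.ne']⟩
  by_cases hne : ∃ y ∈ K, g ⬝ᵥ y = 1
  · have hcomp : IsCompact {y : ι → ℝ | y ∈ K ∧ g ⬝ᵥ y = 1} := by
      refine (isCompact_univ_pi fun _ : ι =>
          isCompact_Icc (a := -ε⁻¹) (b := ε⁻¹)).of_isClosed_subset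
        (K.isClosed.inter (isClosed_eq (by fun_prop) continuous_const)) ?_
      rintro y ⟨hy, hy1⟩ j -
      have := hg y hy j
      rw [hy1] at this
      refine abs_le.1 ?_
      rwa [← one_div, le_div_iff₀' hε]
    obtain ⟨w, ⟨hwK, hw1⟩, hmin⟩ := hcomp.exists_isMinOn hne
      (f := fun y => y ⬝ᵥ C *ᵥ y) (by fun_prop)
    refine ⟨w, hwK, fun v hv => ?_, fun v _ => by rw [hw1, mul_one]⟩
    rcases le_or_gt (g ⬝ᵥ v) 0 with h | h
    · simp [hzero v hv h]
    · have h5 := hmin (hscale v hv h)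
      simp only [Set.mem_ofPred_eq, Matrix.mulVec_smul, dotProduct_smul, smul_dotProduct,
        smul_eq_mul] at h5
      calc (g ⬝ᵥ v) ^ 2 * (w ⬝ᵥ C *ᵥ w)
          ≤ (g ⬝ᵥ v) ^ 2 * ((g ⬝ᵥ v)⁻¹ * ((g ⬝ᵥ v)⁻¹ * (v ⬝ᵥ C *ᵥ v))) := by gcongr
        _ = v ⬝ᵥ C *ᵥ v := by field_simp
  · have : ∀ v ∈ K, v = 0 := fun v hv => hzero v hv <| by
      by_contra! h
      exact hne ⟨_, hscale v hv h⟩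
    exact ⟨0, K.zero_mem, fun v hv => by simp [this v hv], fun v hv => by simp [this v hv]⟩

/-! ### Linear minimization at extreme points -/

/-- The minimizers of a continuous linear form on a compact set are an exposed face, whose extreme
points are extreme in the whole set. Convexity is not needed. -/
theorem exists_extremePoint_isMinOn {E : Type*} [AddCommGroup E] [Module ℝ E]
    [TopologicalSpace E] [T2Space E] [IsTopologicalAddGroup E] [ContinuousSMul ℝ E]
    [LocallyConvexSpace ℝ E] {T : Set E} (hT : IsCompact T) (l : E →L[ℝ] ℝ) {p : E} (hp : p ∈ T) :
    ∃ q ∈ Set.extremePoints ℝ T, l q ≤ l p := by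
  obtain ⟨m, hm, hmin⟩ := hT.exists_isMinOn ⟨p, hp⟩ l.continuous.continuousOn
  have hexp : IsExposed ℝ T {q ∈ T | ∀ r ∈ T, (-l) r ≤ (-l) q} := fun _ => ⟨-l, rfl⟩
  obtain ⟨q, hq⟩ := (hexp.isCompact hT).extremePoints_nonempty
    ⟨m, hm, fun r hr => by simpa using hmin hr⟩
  refine ⟨q, hexp.isExtreme.extremePoints_subset_extremePoints hq, ?_⟩
  simpa using hq.1.2 p hp

/-! ### The Frobenius product -/

section frob
variable {m n : Type*} [Fintype m] [Fintype n]

theorem frob_add (M N N' : Matrix m n ℝ) : frob M (N + N') = frob M N + frob M N' := by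
  simp [frob, Matrix.mul_add]

theorem frob_smul (M N : Matrix m n ℝ) (r : ℝ) : frob M (r • N) = r * frob M N := by
  simp [frob]

theorem frob_comm (M N : Matrix m n ℝ) : frob M N = frob N M := by
  rw [frob, ← Matrix.trace_transpose, Matrix.transpose_mul, Matrix.transpose_transpose, frob]

theorem frob_vecMulVec_right (M : Matrix m n ℝ) (u : m → ℝ) (v : n → ℝ) :
    frob M (Matrix.vecMulVec u v) = u ⬝ᵥ M *ᵥ v := by
  rw [frob, Matrix.mul_vecMulVec, Matrix.trace_vecMulVec, Matrix.mulVec_transpose,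
    Matrix.dotProduct_mulVec]

theorem frob_vecMulVec_left (M : Matrix m n ℝ) (u : m → ℝ) (v : n → ℝ) :
    frob (Matrix.vecMulVec u v) M = u ⬝ᵥ M *ᵥ v := by
  rw [frob_comm, frob_vecMulVec_right]

@[fun_prop]
theorem continuous_frob (M : Matrix m n ℝ) : Continuous (frob M) := by
  unfold frob; fun_prop

end frob

/-! ### Blocks of an arrow matrix -/

section parts
variable {ι κ : Type*}

/-- The block `x` of `[[1, xᵀ, yᵀ], [x, X, Zᵀ], [y, Z, Y]]`, read off the first row. -/
def xPart : Matrix (Unit ⊕ (ι ⊕ κ)) (Unit ⊕ (ι ⊕ κ)) ℝ →ₗ[ℝ] (ι → ℝ) where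
  toFun M j := M (Sum.inl ()) (Sum.inr (Sum.inl j))
  map_add' _ _ := rfl
  map_smul' _ _ := rfl

/-- The block `y` of `[[1, xᵀ, yᵀ], [x, X, Zᵀ], [y, Z, Y]]`, read off the first row. -/
def yPart : Matrix (Unit ⊕ (ι ⊕ κ)) (Unit ⊕ (ι ⊕ κ)) ℝ →ₗ[ℝ] (κ → ℝ) where
  toFun M j := M (Sum.inl ()) (Sum.inr (Sum.inr j))
  map_add' _ _ := rfl
  map_smul' _ _ := rfl

/-- The block `X` of `[[1, xᵀ, yᵀ], [x, X, Zᵀ], [y, Z, Y]]`. -/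
def XPart : Matrix (Unit ⊕ (ι ⊕ κ)) (Unit ⊕ (ι ⊕ κ)) ℝ →ₗ[ℝ] Matrix ι ι ℝ where
  toFun M := M.submatrix (fun j => Sum.inr (Sum.inl j)) (fun j => Sum.inr (Sum.inl j))
  map_add' _ _ := rfl
  map_smul' _ _ := rfl

/-- The block `Y` of `[[1, xᵀ, yᵀ], [x, X, Zᵀ], [y, Z, Y]]`. -/
def YPart : Matrix (Unit ⊕ (ι ⊕ κ)) (Unit ⊕ (ι ⊕ κ)) ℝ →ₗ[ℝ] Matrix κ κ ℝ where
  toFun M := M.submatrix (fun j => Sum.inr (Sum.inr j)) (fun j => Sum.inr (Sum.inr j))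
  map_add' _ _ := rfl
  map_smul' _ _ := rfl

/-- The block `Z` of `[[1, xᵀ, yᵀ], [x, X, Zᵀ], [y, Z, Y]]`. -/
def ZPart : Matrix (Unit ⊕ (ι ⊕ κ)) (Unit ⊕ (ι ⊕ κ)) ℝ →ₗ[ℝ] Matrix κ ι ℝ where
  toFun M := M.submatrix (fun j => Sum.inr (Sum.inr j)) (fun j => Sum.inr (Sum.inl j))
  map_add' _ _ := rfl
  map_smul' _ _ := rfl

@[fun_prop]
theorem continuous_xPart : Continuous (xPart (ι := ι) (κ := κ)) := by
  change Continuous fun (M : Matrix (Unit ⊕ (ι ⊕ κ)) (Unit ⊕ (ι ⊕ κ)) ℝ) (j : ι) =>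
    M (Sum.inl ()) (Sum.inr (Sum.inl j))
  fun_prop

@[fun_prop]
theorem continuous_yPart : Continuous (yPart (ι := ι) (κ := κ)) := by
  change Continuous fun (M : Matrix (Unit ⊕ (ι ⊕ κ)) (Unit ⊕ (ι ⊕ κ)) ℝ) (j : κ) =>
    M (Sum.inl ()) (Sum.inr (Sum.inr j))
  fun_prop

@[fun_prop]
theorem continuous_XPart : Continuous (XPart (ι := ι) (κ := κ)) :=
  continuous_id.matrix_submatrix _ _

@[fun_prop]
theorem continuous_YPart : Continuous (YPart (ι := ι) (κ := κ)) :=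
  continuous_id.matrix_submatrix _ _

@[fun_prop]
theorem continuous_ZPart : Continuous (ZPart (ι := ι) (κ := κ)) :=
  continuous_id.matrix_submatrix _ _

theorem xPart_lift (v : ι ⊕ κ → ℝ) :
    xPart (Matrix.vecMulVec (lift v) (lift v)) = fun j => v (Sum.inl j) := by
  ext j; exact one_mul (v (Sum.inl j))

theorem yPart_lift (v : ι ⊕ κ → ℝ) :
    yPart (Matrix.vecMulVec (lift v) (lift v)) = fun j => v (Sum.inr j) := by
  ext j; exact one_mul (v (Sum.inr j))

theorem XPart_lift (v : ι ⊕ κ → ℝ) : XPart (Matrix.vecMulVec (lift v) (lift v)) =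
    Matrix.vecMulVec (fun j => v (Sum.inl j)) (fun j => v (Sum.inl j)) := rfl

theorem YPart_lift (v : ι ⊕ κ → ℝ) : YPart (Matrix.vecMulVec (lift v) (lift v)) =
    Matrix.vecMulVec (fun j => v (Sum.inr j)) (fun j => v (Sum.inr j)) := rfl

theorem ZPart_lift (v : ι ⊕ κ → ℝ) : ZPart (Matrix.vecMulVec (lift v) (lift v)) =
    Matrix.vecMulVec (fun j => v (Sum.inr j)) (fun j => v (Sum.inl j)) := rfl

/-- Matrices in `GG F` are symmetric with corner entry `1`, so they are
determined by their blocks. -/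
theorem arrowBlock_parts {F : Set (ι ⊕ κ → ℝ)}
    {M : Matrix (Unit ⊕ (ι ⊕ κ)) (Unit ⊕ (ι ⊕ κ)) ℝ} (hM : M ∈ GG F) :
    arrowBlock (xPart M) (XPart M) (yPart M) (YPart M) (ZPart M) = M := by
  ext (⟨⟩ | i | i) (⟨⟩ | j | j)
  · simp [arrowBlock, bordered, GG_corner hM]
  · rfl
  · rfl
  · exact GG_symm hM _ _
  · rfl
  · exact GG_symm hM _ _
  · exact GG_symm hM _ _
  · rfl
  · rfl

end parts

/-! ### Compactness of the projected hulls -/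

theorem isCompact_setOf_abs_entry_le {m n : Type*} (r : ℝ) :
    IsCompact {M : Matrix m n ℝ | ∀ i j, |M i j| ≤ r} := by
  have heq : {M : m → n → ℝ | ∀ i j, |M i j| ≤ r} =
      Set.univ.pi fun _ => Set.univ.pi fun _ => Set.Icc (-r) r := by
    ext M
    simp only [Set.mem_ofPred_eq, abs_le, Set.mem_univ_pi, Set.mem_Icc]
  have h : IsCompact {M : m → n → ℝ | ∀ i j, |M i j| ≤ r} :=
    heq ▸ isCompact_univ_pi fun _ => isCompact_univ_pi fun _ => isCompact_Icc
  exact h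

/-- The pairs `(x, X)` whose entries are bounded by `r` in absolute value. -/
def pairBox (ι : Type*) (r : ℝ) : Set ((ι → ℝ) × Matrix ι ι ℝ) :=
  {p | (∀ j, |p.1 j| ≤ r) ∧ ∀ j k, |p.2 j k| ≤ r}

theorem isCompact_pairBox (ι : Type*) (r : ℝ) : IsCompact (pairBox ι r) := by
  have heq : pairBox ι r =
      (Set.univ.pi fun _ : ι => Set.Icc (-r) r) ×ˢ {M | ∀ i j, |M i j| ≤ r} := by
    ext p
    simp only [pairBox, Set.mem_ofPred_eq, abs_le, Set.mem_prod, Set.mem_univ_pi, Set.mem_Icc]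
  rw [heq]
  exact (isCompact_univ_pi fun _ => isCompact_Icc).prod (isCompact_setOf_abs_entry_le r)

/-- Applied with `e` an inclusion of index sets, this projects a completely positive matrix to a
principal submatrix. -/
theorem submatrix_mem_CPP {ι κ : Type*} {K : Set (ι → ℝ)} {L : Set (κ → ℝ)} (e : κ → ι)
    (h : ∀ v ∈ K, v ∘ e ∈ L) {M : Matrix ι ι ℝ} (hM : M ∈ CPP K) : M.submatrix e e ∈ CPP L := by
  refine convexHull_min (t := (fun M : Matrix ι ι ℝ => M.submatrix e e) ⁻¹' CPP L) ?_ ?_ hM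
  · rintro _ ⟨v, hv, rfl⟩
    exact subset_convexHull ℝ _ ⟨_, h v hv, rfl⟩
  · exact (convex_convexHull ℝ _).is_linear_preimage ⟨fun _ _ => rfl, fun _ _ => rfl⟩

namespace Problem
variable {nx ny S : ℕ} (P : Problem nx ny S)

theorem XX0_mem {x : Fin nx → ℝ} {X : Matrix (Fin nx) (Fin nx) ℝ} (h : (x, X) ∈ P.XX0) :
    x ∈ P.K0 ∧ P.f0 ⬝ᵥ x = P.d0 := by
  refine border_mem_of_mem_GG (T := {v : Fin nx → ℝ | v ∈ P.K0 ∧ P.f0 ⬝ᵥ v = P.d0}) ?_ ?_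
    subset_rfl h
  · exact P.K0.isClosed.inter (isClosed_eq (by fun_prop) continuous_const)
  · intro u hu v hv a b ha hb hab
    refine ⟨P.K0.add_mem (P.K0.smul_mem hu.1 ha) (P.K0.smul_mem hv.1 hb), ?_⟩
    rw [dotProduct_add, dotProduct_smul, dotProduct_smul, hu.2, hv.2, ← add_smul, hab, one_smul]

theorem isClosed_F (i : Fin S) : IsClosed (P.F i) := by
  refine IsClosed.inter (IsClosed.inter ?_ ?_) (isClosed_eq (by fun_prop) continuous_const)
  · exact P.K0.isClosed.preimage (f := fun (v : Fin nx ⊕ Fin ny → ℝ) j => v (Sum.inl j))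
      (by fun_prop)
  · exact (P.K i).isClosed.preimage (f := fun (v : Fin nx ⊕ Fin ny → ℝ) j => v (Sum.inr j))
      (by fun_prop)

theorem convex_F (i : Fin S) : Convex ℝ (P.F i) := by
  intro u hu v hv a b ha hb hab
  refine ⟨⟨P.K0.add_mem (P.K0.smul_mem hu.1.1 ha) (P.K0.smul_mem hv.1.1 hb),
    (P.K i).add_mem ((P.K i).smul_mem hu.1.2 ha) ((P.K i).smul_mem hv.1.2 hb)⟩, ?_⟩
  have h1 := hu.2
  have h2 := hv.2
  change P.f i ⬝ᵥ (a • (fun j => u (Sum.inl j)) + b • fun j => v (Sum.inl j)) +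
    P.g i ⬝ᵥ (a • (fun j => u (Sum.inr j)) + b • fun j => v (Sum.inr j)) = _
  simp only [dotProduct_add, dotProduct_smul, smul_eq_mul]
  linear_combination a * h1 + b * h2 + P.d i * hab

theorem exists_of_mem_XXi {i : Fin S} {p : (Fin nx → ℝ) × Matrix (Fin nx) (Fin nx) ℝ}
    (h : p ∈ P.XXi i) : ∃ y ∈ P.K i, P.f i ⬝ᵥ p.1 + P.g i ⬝ᵥ y = P.d i := by
  obtain ⟨y, Y, Z, h⟩ := h
  have := border_mem_of_mem_GG (P.isClosed_F i) (P.convex_F i) subset_rfl h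
  exact ⟨y, this.1.2, this.2⟩

/-- The affine form `d² - 2 d fᵀx + f fᵀ • X`, which is `(d - fᵀx)²` at `X = x xᵀ`. -/
def slackSq (i : Fin S) (p : (Fin nx → ℝ) × Matrix (Fin nx) (Fin nx) ℝ) : ℝ :=
  P.d i ^ 2 - 2 * P.d i * (P.f i ⬝ᵥ p.1) + P.f i ⬝ᵥ p.2 *ᵥ P.f i

/-- On `Fᵢ` one has `ε |yₖ| ≤ gᵀ y = d - fᵀ x`; squaring gives an inequality that is affine in the
lifted variables, so it passes to the closed convex hull. -/
theorem mul_YPart_le {i : Fin S} {ε : ℝ} (hε : 0 < ε)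
    (hg : ∀ y ∈ P.K i, ∀ j, ε * |y j| ≤ P.g i ⬝ᵥ y)
    {M : Matrix (Unit ⊕ (Fin nx ⊕ Fin ny)) (Unit ⊕ (Fin nx ⊕ Fin ny)) ℝ} (hM : M ∈ GG (P.F i))
    (k : Fin ny) : ε ^ 2 * YPart M k k ≤ P.slackSq i (xPart M, XPart M) := by
  have := nonneg_of_mem_GG (l := fun M => P.d i ^ 2 * M (Sum.inl ()) (Sum.inl ())
      - 2 * P.d i * (P.f i ⬝ᵥ xPart M) + P.f i ⬝ᵥ XPart M *ᵥ P.f i - ε ^ 2 * YPart M k k)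
    ⟨fun M N => by
      simp only [map_add, Matrix.add_apply, Matrix.add_mulVec, dotProduct_add]; ring,
     fun r M => by
      simp only [map_smul, Matrix.smul_apply, Matrix.smul_mulVec, dotProduct_smul,
        smul_eq_mul]; ring⟩ (by fun_prop) ?_ hM
  · rw [GG_corner hM] at this
    rw [slackSq]; linarith
  · intro v hv
    rw [xPart_lift, XPart_lift, YPart_lift, Matrix.vecMulVec_mulVec]
    have h1 := hv.2
    have h2 := hg _ hv.1.2 k
    have h3 : (ε * |v (Sum.inr k)|) ^ 2 ≤ (P.g i ⬝ᵥ fun k => v (Sum.inr k)) ^ 2 :=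
      pow_le_pow_left₀ (by positivity) h2 2
    rw [mul_pow, sq_abs, ← sub_eq_of_eq_add' h1.symm] at h3
    simp only [Matrix.vecMulVec_apply, lift, Sum.elim_inl, op_smul_eq_smul, dotProduct_smul,
      smul_eq_mul]
    rw [dotProduct_comm _ (P.f i)]
    nlinarith

/-- A projection of a closed set need not be closed. Here the fibres over a bounded set of pairs are
bounded: `mul_YPart_le` bounds the diagonal of `Y`, and the diagonal bounds the other entries. -/
theorem isClosed_XXi_inter_pairBox {i : Fin S}
    (hg : P.g i ∈ interior (dualCone (P.K i : Set (Fin ny → ℝ)))) (r : ℝ) :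
    IsClosed (P.XXi i ∩ pairBox (Fin nx) r) := by
  obtain ⟨ε, hε, hg⟩ := exists_pos_mul_abs_le_dotProduct hg
  have hslack : Continuous (P.slackSq i) := by unfold slackSq; fun_prop
  obtain ⟨b, hb⟩ := (isCompact_pairBox (Fin nx) r).bddAbove_image hslack.continuousOn
  let π : Matrix (Unit ⊕ (Fin nx ⊕ Fin ny)) (Unit ⊕ (Fin nx ⊕ Fin ny)) ℝ →
    (Fin nx → ℝ) × Matrix (Fin nx) (Fin nx) ℝ := fun M => (xPart M, XPart M)
  have hπ : Continuous π := by fun_prop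
  set T := GG (P.F i) ∩ π ⁻¹' pairBox (Fin nx) r
  have hTcomp : IsCompact T := by
    refine (isCompact_setOf_abs_entry_le (max (max 1 r) (b / ε ^ 2))).of_isClosed_subset
      (isClosed_closure.inter ((isCompact_pairBox _ r).isClosed.preimage hπ)) ?_
    rintro M ⟨hM, hbox⟩
    have hdiag : ∀ a, M a a ≤ max (max 1 r) (b / ε ^ 2) := by
      rintro (⟨⟩ | j | k)
      · rw [GG_corner hM]; simp
      · exact (le_abs_self _).trans ((hbox.2 j j).trans (by simp))
      · refine le_max_of_le_right ?_
        rw [le_div_iff₀' (by positivity)]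
        exact (P.mul_YPart_le hε hg hM k).trans (hb ⟨_, hbox, rfl⟩)
    intro a c
    linarith [GG_abs_le hM a c, hdiag a, hdiag c]
  have himage : P.XXi i ∩ pairBox (Fin nx) r = π '' T := by
    ext p
    constructor
    · rintro ⟨⟨y, Y, Z, h⟩, hp⟩
      exact ⟨_, ⟨h, hp⟩, rfl⟩
    · rintro ⟨M, ⟨hM, hbox⟩, rfl⟩
      exact ⟨⟨yPart M, YPart M, ZPart M, (arrowBlock_parts hM).symm ▸ hM⟩, hbox⟩
  rw [himage]
  exact (hTcomp.image hπ).isClosed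

theorem isCompact_XX (hg : ∀ i, P.g i ∈ interior (dualCone (P.K i : Set (Fin ny → ℝ))))
    (hb : IsBoundedPairs P.XX) : IsCompact P.XX := by
  obtain ⟨r, hr⟩ := hb
  have hbox : P.XX ⊆ pairBox (Fin nx) r := hr
  -- The sets `𝒳ᵢ` are only known to be closed after intersection with the box.
  have heq : P.XX = (P.XX0 ∩ pairBox (Fin nx) r) ∩
      {p | ∀ i, p ∈ P.XXi i ∩ pairBox (Fin nx) r} := by
    ext p
    constructor
    · intro hp
      exact ⟨⟨hp.1, hbox hp⟩, fun i => ⟨Set.mem_iInter.1 hp.2 i, hbox hp⟩⟩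
    · rintro ⟨⟨h0, h⟩, hi⟩
      exact ⟨h0, Set.mem_iInter.2 fun i => (hi i).1⟩
  have hc0 : IsClosed P.XX0 := by
    refine isClosed_closure.preimage
      (f := fun p : (Fin nx → ℝ) × Matrix (Fin nx) (Fin nx) ℝ => bordered p.1 p.2) ?_
    unfold bordered
    refine Continuous.matrix_fromBlocks continuous_const ?_ ?_ continuous_snd
    · exact continuous_matrix fun _ j => (continuous_apply j).comp continuous_fst
    · exact continuous_matrix fun j _ => (continuous_apply j).comp continuous_fst
  rw [heq, Set.ofPred_forall]
  exact ((isCompact_pairBox _ r).inter_left hc0).inter_right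
    (isClosed_iInter fun i => P.isClosed_XXi_inter_pairBox (hg i) r)

/-! ### The relaxation and its affine lower bound -/

theorem arrowBlock_mem_GG {p : LiftedPoint nx ny S} (hp : p ∈ P.relaxedFeasible) (i : Fin S) :
    arrowBlock p.x p.X (p.y i) (p.Y i) (p.Z i) ∈ GG (P.F i) := by
  obtain ⟨-, -, h1, h2, h3⟩ := hp
  have hF : P.F i = {v | v ∈ prodSet (P.K0 : Set (Fin nx → ℝ)) (P.K i : Set (Fin ny → ℝ)) ∧
      Sum.elim (P.f i) (P.g i) ⬝ᵥ v = P.d i} := by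
    ext v
    simp [F, dotProduct]
  rw [hF]
  refine bordered_mem_GG ?_ ?_ (h3 i) ?_ ?_
  · exact fun u hu v hv => ⟨P.K0.add_mem hu.1 hv.1, (P.K i).add_mem hu.2 hv.2⟩
  · exact fun c hc v hv => ⟨P.K0.smul_mem hv.1 hc, (P.K i).smul_mem hv.2 hc⟩
  · rw [sumElim_dotProduct_sumElim]
    exact h1 i
  · have := h2 i
    rw [frob_vecMulVec_left, frob_vecMulVec_left, frob_vecMulVec_left] at this
    have hcomm : P.g i ⬝ᵥ p.Z i *ᵥ P.f i = P.f i ⬝ᵥ (p.Z i)ᵀ *ᵥ P.g i := by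
      rw [Matrix.mulVec_transpose, Matrix.dotProduct_mulVec, dotProduct_comm]
    rw [Matrix.fromBlocks_mulVec, sumElim_dotProduct_sumElim]
    simp only [Sum.elim_comp_inl, Sum.elim_comp_inr, dotProduct_add, hcomm]
    linarith

theorem mem_XX_of_mem_relaxedFeasible (hS : 1 ≤ S) {p : LiftedPoint nx ny S}
    (hp : p ∈ P.relaxedFeasible) : (p.x, p.X) ∈ P.XX := by
  refine ⟨?_, Set.mem_iInter.2 fun i => ⟨_, _, _, P.arrowBlock_mem_GG hp i⟩⟩
  -- Membership in `𝒳₀` comes from the block of index `0`, which exists because `1 ≤ S`.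
  obtain ⟨h1, h2, -, -, h3⟩ := hp
  refine bordered_mem_GG (fun u hu v hv => P.K0.add_mem hu hv)
    (fun c hc v hv => P.K0.smul_mem hv hc) ?_ h1 (by rw [← h2, frob_vecMulVec_left])
  have := submatrix_mem_CPP (L := prodSet ray (P.K0 : Set (Fin nx → ℝ)))
    (Sum.elim Sum.inl fun j => Sum.inr (Sum.inl j)) (fun v hv => ⟨hv.1, hv.2.1⟩) (h3 ⟨0, hS⟩)
  have heq : bordered p.x p.X = (arrowBlock p.x p.X (p.y ⟨0, hS⟩) (p.Y ⟨0, hS⟩)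
      (p.Z ⟨0, hS⟩)).submatrix (Sum.elim Sum.inl fun j => Sum.inr (Sum.inl j))
        (Sum.elim Sum.inl fun j => Sum.inr (Sum.inl j)) := by
    ext (a | j) (b | k) <;> rfl
  rwa [heq]

/-- The terms of block `i` of the relaxed objective, with `Bᵢ = b gᵀ` and `cᵢ = β g`, are bounded
below by a function affine in `(x, X)`: on `Fᵢ` substitute `gᵀ y = d - fᵀ x` in the terms of `b` and
`β` and use `yᵀ C y ≥ (wᵀ C w) (gᵀ y)²`. -/
theorem affine_le_of_mem_GG {i : Fin S} {β : ℝ} {b : Fin nx → ℝ} {w : Fin ny → ℝ}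
    (hw : ∀ v ∈ P.K i, (P.g i ⬝ᵥ v) ^ 2 * (w ⬝ᵥ P.C i *ᵥ w) ≤ v ⬝ᵥ P.C i *ᵥ v)
    {M : Matrix (Unit ⊕ (Fin nx ⊕ Fin ny)) (Unit ⊕ (Fin nx ⊕ Fin ny)) ℝ} (hM : M ∈ GG (P.F i)) :
    P.d i * (b ⬝ᵥ xPart M) - b ⬝ᵥ XPart M *ᵥ P.f i
        + (w ⬝ᵥ P.C i *ᵥ w) * P.slackSq i (xPart M, XPart M)
        + β * (P.d i - P.f i ⬝ᵥ xPart M) ≤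
      b ⬝ᵥ (ZPart M)ᵀ *ᵥ P.g i + frob (P.C i) (YPart M) + β * (P.g i ⬝ᵥ yPart M) := by
  set m := w ⬝ᵥ P.C i *ᵥ w
  have := nonneg_of_mem_GG (l := fun M =>
      b ⬝ᵥ (ZPart M)ᵀ *ᵥ P.g i + frob (P.C i) (YPart M) + β * (P.g i ⬝ᵥ yPart M)
      - (P.d i * (b ⬝ᵥ xPart M) - b ⬝ᵥ XPart M *ᵥ P.f i
        + m * (P.d i ^ 2 * M (Sum.inl ()) (Sum.inl ())
          - 2 * P.d i * (P.f i ⬝ᵥ xPart M) + P.f i ⬝ᵥ XPart M *ᵥ P.f i)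
        + β * (P.d i * M (Sum.inl ()) (Sum.inl ()) - P.f i ⬝ᵥ xPart M)))
    ⟨fun M N => by
      simp only [map_add, Matrix.add_apply, Matrix.transpose_add, Matrix.add_mulVec,
        dotProduct_add, frob_add]; ring,
     fun r M => by
      simp only [map_smul, Matrix.smul_apply, Matrix.transpose_smul, Matrix.smul_mulVec,
        dotProduct_smul, smul_eq_mul, frob_smul]; ring⟩ (by fun_prop) ?_ hM
  · simp only [GG_corner hM] at this
    rw [slackSq]; linarith
  · intro v hv
    have h1 := hv.2
    have h2 := hw _ hv.1.2
    rw [xPart_lift, yPart_lift, XPart_lift, YPart_lift, ZPart_lift, frob_vecMulVec_right]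
    simp only [Matrix.transpose_vecMulVec, Matrix.vecMulVec_mulVec, Matrix.vecMulVec_apply, lift,
      Sum.elim_inl, op_smul_eq_smul, dotProduct_smul, smul_eq_mul, dotProduct_comm _ (P.f i),
      dotProduct_comm _ (P.g i)]
    set fx := P.f i ⬝ᵥ fun j => v (Sum.inl j)
    set gy := P.g i ⬝ᵥ fun j => v (Sum.inr j)
    rw [← h1]
    linarith

/-- The affine function of `(x, X)` obtained from the relaxed objective when each block is replaced
by its lower bound; `m i` stands for the minimum of `yᵀ Cᵢ y` on the slice `gᵢᵀ y = 1` of `Kᵢ`, and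
for `0` if the slice is empty. -/
def reduced (β : Fin S → ℝ) (b : Fin S → Fin nx → ℝ) (m : Fin S → ℝ)
    (p : (Fin nx → ℝ) × Matrix (Fin nx) (Fin nx) ℝ) : ℝ :=
  frob P.A p.2 + P.a ⬝ᵥ p.1 + ∑ i, (P.d i * (b i ⬝ᵥ p.1) - b i ⬝ᵥ p.2 *ᵥ P.f i
    + m i * P.slackSq i p + β i * (P.d i - P.f i ⬝ᵥ p.1))

theorem exists_reduced_eq (β : Fin S → ℝ) (b : Fin S → Fin nx → ℝ) (m : Fin S → ℝ) :
    ∃ (l : ((Fin nx → ℝ) × Matrix (Fin nx) (Fin nx) ℝ) →L[ℝ] ℝ) (c : ℝ),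
      ∀ p, P.reduced β b m p = l p + c := by
  let l : ((Fin nx → ℝ) × Matrix (Fin nx) (Fin nx) ℝ) →ₗ[ℝ] ℝ :=
    { toFun := fun p => frob P.A p.2 + P.a ⬝ᵥ p.1 + ∑ i, (P.d i * (b i ⬝ᵥ p.1)
        - b i ⬝ᵥ p.2 *ᵥ P.f i + m i * (P.f i ⬝ᵥ p.2 *ᵥ P.f i - 2 * P.d i * (P.f i ⬝ᵥ p.1))
        - β i * (P.f i ⬝ᵥ p.1))
      map_add' := fun p q => by
        simp only [Prod.fst_add, Prod.snd_add, frob_add, dotProduct_add, Matrix.add_mulVec,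
          mul_add, mul_sub, Finset.sum_add_distrib, Finset.sum_sub_distrib]
        ring
      map_smul' := fun r p => by
        simp only [Prod.smul_fst, Prod.smul_snd, frob_smul, dotProduct_smul, Matrix.smul_mulVec,
          smul_eq_mul, RingHom.id_apply, mul_add, Finset.mul_sum]
        congr 1
        exact Finset.sum_congr rfl fun i _ => by ring }
  have hl : Continuous l := by
    change Continuous fun p : (Fin nx → ℝ) × Matrix (Fin nx) (Fin nx) ℝ => _
    simp only [l, LinearMap.coe_mk, AddHom.coe_mk]
    fun_prop
  refine ⟨⟨l, hl⟩, ∑ i, (m i * P.d i ^ 2 + β i * P.d i), fun p => ?_⟩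
  change _ = frob P.A p.2 + P.a ⬝ᵥ p.1 + ∑ i, _ + _
  simp only [reduced, slackSq, mul_add, mul_sub, Finset.sum_add_distrib, Finset.sum_sub_distrib]
  ring

/-! ### Comparing the optimal values -/

theorem relaxedVal_le_val : P.relaxedVal ≤ P.val := by
  refine le_iInf₂ fun q hq => ?_
  let p : LiftedPoint nx ny S := ⟨q.1, Matrix.vecMulVec q.1 q.1, q.2,
    fun i => Matrix.vecMulVec (q.2 i) (q.2 i), fun i => Matrix.vecMulVec (q.2 i) q.1⟩
  obtain ⟨h0, hK0, h1, hK⟩ := hq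
  have hp : p ∈ P.relaxedFeasible := by
    refine ⟨h0, ?_, h1, fun i => ?_, fun i => ?_⟩
    · rw [frob_vecMulVec_left, Matrix.vecMulVec_mulVec]
      simp [dotProduct_comm q.1, h0, sq]
    · simp only [p, Matrix.transpose_vecMulVec, frob_vecMulVec_left, Matrix.vecMulVec_mulVec,
        op_smul_eq_smul, dotProduct_smul, smul_eq_mul, dotProduct_comm _ (P.f i),
        dotProduct_comm _ (P.g i)]
      rw [← h1 i]; ring
    · refine subset_convexHull ℝ _ ⟨lift (Sum.elim q.1 (q.2 i)),
        ⟨by simp [ray, lift], hK0, hK i⟩, ?_⟩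
      ext (⟨⟩ | j | j) (⟨⟩ | k | k) <;>
        simp [arrowBlock, bordered, lift, p, Matrix.vecMulVec_apply, mul_comm]
  refine (iInf₂_le p hp).trans (le_of_eq ?_)
  simp only [relaxedObjective, objective, p, Matrix.transpose_vecMulVec, frob_vecMulVec_right]

/-- The affine function `reduced` bounds the relaxed objective from below and attains its minimum
over `𝒳` at an extreme point `(x, x xᵀ)`, where it equals the objective at `yᵢ = (gᵢᵀ vᵢ) wᵢ`. -/
theorem exists_feasible_objective_le (hS : 1 ≤ S) {β : Fin S → ℝ} {b : Fin S → Fin nx → ℝ}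
    (hc : ∀ i, P.c i = β i • P.g i) (hB : ∀ i, P.B i = Matrix.vecMulVec (b i) (P.g i))
    (hg : ∀ i, P.g i ∈ interior (dualCone (P.K i : Set (Fin ny → ℝ))))
    (hb : IsBoundedPairs P.XX)
    (hext : ∀ p ∈ Set.extremePoints ℝ P.XX, p.2 = Matrix.vecMulVec p.1 p.1)
    {p : LiftedPoint nx ny S} (hp : p ∈ P.relaxedFeasible) :
    ∃ q ∈ P.feasible, P.objective q ≤ P.relaxedObjective p := by
  have hmin : ∀ i, ∃ w ∈ P.K i,
      (∀ v ∈ P.K i, (P.g i ⬝ᵥ v) ^ 2 * (w ⬝ᵥ P.C i *ᵥ w) ≤ v ⬝ᵥ P.C i *ᵥ v) ∧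
      ∀ v ∈ P.K i, (P.g i ⬝ᵥ v) * (P.g i ⬝ᵥ w) = P.g i ⬝ᵥ v := fun i => by
    obtain ⟨ε, hε, h⟩ := exists_pos_mul_abs_le_dotProduct (hg i)
    exact exists_minimizer_on_slice (P.K i) (P.C i) hε h
  choose w hwK hwmin hwone using hmin
  let m : Fin S → ℝ := fun i => w i ⬝ᵥ P.C i *ᵥ w i
  have hle : P.reduced β b m (p.x, p.X) ≤ P.relaxedObjective p := by
    refine add_le_add le_rfl (Finset.sum_le_sum fun i _ => ?_)
    rw [hB, frob_vecMulVec_left, hc, smul_dotProduct, smul_eq_mul]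
    exact P.affine_le_of_mem_GG (hwmin i) (P.arrowBlock_mem_GG hp i)
  -- `Matrix` does not unfold to a function type during instance search.
  have : LocallyConvexSpace ℝ (Matrix (Fin nx) (Fin nx) ℝ) :=
    inferInstanceAs (LocallyConvexSpace ℝ (Fin nx → Fin nx → ℝ))
  obtain ⟨l, c, hl⟩ := P.exists_reduced_eq β b m
  obtain ⟨e, he, hel⟩ := exists_extremePoint_isMinOn (P.isCompact_XX hg hb) l
    (P.mem_XX_of_mem_relaxedFeasible hS hp)
  have heX := hext e he
  have hered : P.reduced β b m e ≤ P.reduced β b m (p.x, p.X) := by rw [hl, hl]; linarith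
  obtain ⟨he0, hei⟩ := he.1
  obtain ⟨hx0, hxd⟩ := P.XX0_mem he0
  choose v hvK hv using fun i => P.exists_of_mem_XXi (Set.mem_iInter.1 hei i)
  -- `gᵢᵀ vᵢ = dᵢ - fᵢᵀ x`, so the scaled minimizer satisfies the linking constraint.
  refine ⟨(e.1, fun i => (P.g i ⬝ᵥ v i) • w i), ⟨hxd, hx0, fun i => ?_, fun i => ?_⟩,
    le_trans (le_of_eq ?_) (hered.trans hle)⟩
  · rw [dotProduct_smul, smul_eq_mul, hwone i _ (hvK i), hv]
  · refine (P.K i).smul_mem (hwK i) ?_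
    have h0 := interior_subset (hg i) (hvK i)
    simpa [dotProductBilin, dotProduct_comm (v i)] using h0
  · rw [objective, reduced, heX, frob_vecMulVec_right]
    congr 1
    refine Finset.sum_congr rfl fun i _ => ?_
    simp only [hB, hc, slackSq, heX, Matrix.vecMulVec_mulVec, op_smul_eq_smul, dotProduct_smul,
      smul_dotProduct, Matrix.mulVec_smul, smul_eq_mul,
      dotProduct_comm _ (P.f i), dotProduct_comm _ (b i)]
    rw [← hv i]
    linear_combination (b i ⬝ᵥ e.1 + β i) * hwone i _ (hvK i)

end Problem

end ConicQP

end

theorem mainTheorem2 {nx ny S : ℕ} (hS : 1 ≤ S) (P : ConicQP.Problem nx ny S) :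
    P.relaxedVal ≤ P.val ∧
    ((∃ (β : Fin S → ℝ) (b : Fin S → Fin nx → ℝ),
        (∀ i, P.c i = β i • P.g i) ∧ ∀ i, P.B i = Matrix.vecMulVec (b i) (P.g i)) →
      (∀ i, P.g i ∈ interior (ConicQP.dualCone (P.K i : Set (Fin ny → ℝ)))) →
      ConicQP.IsBoundedPairs P.XX →
      (∀ p ∈ Set.extremePoints ℝ P.XX, p.2 = Matrix.vecMulVec p.1 p.1) →
      P.relaxedVal = P.val) := by
  refine ⟨P.relaxedVal_le_val, ?_⟩
  rintro ⟨β, b, hc, hB⟩ hg hb hext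
  refine le_antisymm P.relaxedVal_le_val (le_iInf₂ fun p hp => ?_)
  obtain ⟨q, hq, hle⟩ := P.exists_feasible_objective_le hS hc hB hg hb hext hp
  exact (iInf₂_le q hq).trans (EReal.coe_le_coe_iff.2 hle)
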